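/- **Setting.** Let $k\ge 2$ be an integer and $\gamma>0$. Consider the asymptotic single-layer counter braid in which every flow node has degree $k$ and the number of other flows of a counter reached through an edge is Poisson with mean $\gamma$, so that $\rho(z)=\sum_{i\ge0}e^{-\gamma}(\gamma z)^i/i!$ is the edge-perspective counter degree distribution. The flow sizes are independent with a given law on $\mathbb N$ with minimum $f_{\min}$; let $\varepsilon$ be the probability of a size $>f_{\min}$. The BP decoder starts with all flow-to-counter messages equal to $f_{\min}$. In iteration $\ell\ge1$ a counter with value $\phi$ (the sum of its flow sizes) sends to a flow the maximum of $f_{\min}$ and of $\phi$ minus the messages of its other flows, and a flow sends to a counter the minimum ($\ell$ odd) or the maximum ($\ell$ even) of the messages of its other $k-1$ counters. Put $$g(x)=1-\rho\bigl(1-(1-\rho(1-x))^{k-1}\bigr),\qquad f(y;\varepsilon)=\varepsilon y^{k-1}.$$ The density evolution (DE) fixed points are the $x\in[0,1]$ with $x=f(g(x);\varepsilon)$, and $x(\varepsilon)$ denotes the largest of them. For a bipartite ensemble with flow degree $k$ and counter node update $G$ (the probability that a counter-to-flow message is wrong, as a function of the probability that an incoming message is wrong), the EBP EXIT curve is the parametric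 curve $z\mapsto\bigl(z/G(z)^{k-1},\,G(z)^k\bigr)$, $z\in(0,1]$. On the equivalent graph a counter node, seen along an edge, is a tree of depth three (a counter, its other flows, their $k-1$ other counters, and the other flows of these, which are the leaves), and for the counter braid $G=g$; write $\varepsilon(x)=x/g(x)^{k-1}$ and $h^{\rm EBP}(x)=g(x)^k$. A number $\bar\varepsilon$ is an area threshold if $\bar\varepsilon=\varepsilon(x^*)$ for some $x^*\in(0,1]$ with $\int_{x^*}^1h^{\rm EBP}\,d\varepsilon(x)=\int_0^1h^{\rm EBP}\,d\varepsilon(x)$ and $\varepsilon(x')\ne\varepsilon(x^*)$ for all $x'\in(x^*,1]$. **Residual graph.** After $2\ell$ iterations, remove from the tree of depth three below an edge all leaves whose message of iteration $2\ell$ towards the root is correct, and all inner flows whose message of iteration $2\ell+1$ towards the root is correct; condition on the event that some flow next to the root counter stays. The expected residual ensemble when the peeling decoder (equivalent to BP) stops is the limit, as $\ell\to\infty$, of the law of this tree. Its counter node update is the expected probability that the message of the root counter is wrong when the messages of the leaves of the residual tree are wrong independently with probability $z$ (a counter message is correct iff all messages coming into it are, a message of an inner flow is wrong iff all messages coming into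 it are). **Theorem.** 1. Suppose $x=x(\varepsilon)>0$. Then the expected residual ensemble exists as a probability law on finite trees; in it, every counter has, besides the flow towards the root, at least one residual flow. Its counter node update is positive and equals $1-\tilde\rho(1-z;x)$ for $z\in(0,1]$, where $$\tilde\rho(z;x)=1-\frac{g(x-zx)}{g(x)},$$ and its EBP EXIT curve is given in parametric form, for $z\in(0,1]$, by $$(\tilde\varepsilon,\tilde h^{\rm EBP})=\bigl(\tilde\varepsilon(z;x),\,(1-\tilde\rho(1-z;x))^k\bigr),\qquad \tilde\varepsilon(z;x)=\frac{z}{(1-\tilde\rho(1-z;x))^{k-1}}.$$ 2. Let $\varepsilon\in\mathbb R$ be such that $x=x(\varepsilon)$ exists. If $\varepsilon$ is an area threshold, then $x>0$ and the area $\int_0^1\tilde h^{\rm EBP}(z;x)\,d\tilde\varepsilon(z;x)=\int_0^1\tilde h^{\rm EBP}(z;x)\,\frac{d\tilde\varepsilon}{dz}(z;x)\,dz$ exists and is equal to zero. Conversely, if $x>0$ and this area is zero, then $\varepsilon$ is an area threshold. -/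

import Mathlib

open Filter Topology MeasureTheory ProbabilityTheory
open scoped NNReal ENNReal

noncomputable section

namespace CounterBraid

/-! ### Density evolution and EBP EXIT curves -/

/-- The edge-perspective (Poisson) counter degree distribution
`ρ(z) = ∑ i, e^{-γ} (γ z)^i / i!`. -/
def rho (γ z : ℝ) : ℝ := ∑' i : ℕ, Real.exp (-γ) * (γ * z) ^ i / (i.factorial : ℝ)

/-- The flow node update `f(y; ε) = ε y^{k-1}`. -/
def f (k : ℕ) (ε y : ℝ) : ℝ := ε * y ^ (k - 1)

/-- The counter node update of the equivalent graph,
`g(x) = 1 - ρ(1 - (1 - ρ(1 - x))^{k-1})`. -/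
def g (k : ℕ) (γ x : ℝ) : ℝ := 1 - rho γ (1 - (1 - rho γ (1 - x)) ^ (k - 1))

/-- `x` is the largest fixed point in `[0,1]` of the density evolution recursion `x = f(g(x); ε)`. -/
def IsLargestFixedPoint (k : ℕ) (γ ε x : ℝ) : Prop :=
  IsGreatest {u : ℝ | u ∈ Set.Icc (0 : ℝ) 1 ∧ u = f k ε (g k γ u)} x

/-- First coordinate of the EBP EXIT curve of a bipartite ensemble with flow degree `k` and counter
node update `G`: the solution `ε` of the fixed-point equation `x = ε G(x)^{k-1}`. -/
def ebpEps (k : ℕ) (G : ℝ → ℝ) (x : ℝ) : ℝ := x / G x ^ (k - 1)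

/-- Second coordinate of the EBP EXIT curve of a bipartite ensemble with flow degree `k` and counter
node update `G`. -/
def ebpH (k : ℕ) (G : ℝ → ℝ) (x : ℝ) : ℝ := G x ^ k

/-- `e` is an area threshold: `e = ε(x⋆)` for a point of the EBP EXIT curve of the counter braid
with `∫_{x⋆}^1 h dε = ∫_0^1 h dε`, and no `x' ∈ (x⋆, 1]` has `ε(x') = ε(x⋆)`. The parameter `0` is
excluded because `ε(0) = 0 / 0` is not a point of the curve. -/
def IsAreaThreshold (k : ℕ) (γ e : ℝ) : Prop :=
  ∃ xs ∈ Set.Ioc (0 : ℝ) 1,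
    (∫ x in xs..1, ebpH k (g k γ) x * deriv (ebpEps k (g k γ)) x) =
      (∫ x in (0 : ℝ)..1, ebpH k (g k γ) x * deriv (ebpEps k (g k γ)) x) ∧
    (∀ x' ∈ Set.Ioc xs 1, ebpEps k (g k γ) x' ≠ ebpEps k (g k γ) xs) ∧
    e = ebpEps k (g k γ) xs

/-- `ρ̃(z; x) = 1 - g(x - z x) / g(x)`. -/
def rhoTilde (k : ℕ) (γ x z : ℝ) : ℝ := 1 - g k γ (x - z * x) / g k γ x

/-- `ε̃(z; x) = z / (1 - ρ̃(1 - z; x))^{k-1}`. -/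
def epsTilde (k : ℕ) (γ x z : ℝ) : ℝ := z / (1 - rhoTilde k γ x (1 - z)) ^ (k - 1)

/-- `h̃(z; x) = (1 - ρ̃(1 - z; x))^k`. -/
def hTilde (k : ℕ) (γ x z : ℝ) : ℝ := (1 - rhoTilde k γ x (1 - z)) ^ k

/-! ### The asymptotic counter braid ensemble and its BP decoder -/

/-- The law of `n` independent samples of `p`, as a list. -/
def iidList {α : Type} (p : PMF α) : ℕ → PMF (List α)
  | 0 => PMF.pure []
  | n + 1 => p.bind fun a => (iidList p n).map fun l => a :: l

/-- The law of a family of `n` independent samples of `p`. -/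
def iidFamily {α : Type} (p : PMF α) : (n : ℕ) → PMF (Fin n → α)
  | 0 => PMF.pure Fin.elim0
  | n + 1 => p.bind fun a => (iidFamily p n).map fun v => Fin.cons a v

/-- The computation tree of depth `ℓ` of a flow-to-counter message: the size of the flow `f` and,
for `ℓ > 0`, for each of the `k - 1` other counters of `f` the list of the trees of the other flows
of that counter. -/
def FlowTree (k : ℕ) : ℕ → Type
  | 0 => ℕ
  | ℓ + 1 => ℕ × (Fin (k - 1) → List (FlowTree k ℓ))

/-- The size of the flow at the root. -/
def rootSize (k : ℕ) : (ℓ : ℕ) → FlowTree k ℓ → ℤ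
  | 0, s => (show ℕ from s : ℕ)
  | _ + 1, (s, _) => (s : ℤ)

/-- The BP message `μ^{(ℓ)}` sent by the root of a computation tree towards its parent counter.
In the recursion, the counter `j` has the value `φ = s + ∑ f', size f'` and sends
`ψ = max (φ - ∑ f', μ^{(ℓ)}_{f'}) f_min`; the flow takes the minimum over `j` of these messages in
odd iterations and the maximum in even iterations. -/
def bpMessage (k fmin : ℕ) : (ℓ : ℕ) → FlowTree k ℓ → ℤ
  | 0, _ => (fmin : ℤ)
  | ℓ + 1, (s, cs) =>
    let ψ : Fin (k - 1) → ℤ := fun j =>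
      max (((s : ℤ) + ((cs j).map (rootSize k ℓ)).sum) - ((cs j).map (bpMessage k fmin ℓ)).sum)
        (fmin : ℤ)
    if Odd (ℓ + 1) then ⨅ j, ψ j else ⨆ j, ψ j

/-- The message of the root in iteration `ℓ` differs from the size of its flow. -/
def IsWrong (k fmin ℓ : ℕ) (t : FlowTree k ℓ) : Prop := bpMessage k fmin ℓ t ≠ rootSize k ℓ t

/-- The number of other flows of the counter reached through an edge: the exponent law of `ρ`. -/
def otherFlows (γ : ℝ≥0) : PMF ℕ := (poissonMeasure γ).toPMF

/-- The law of the computation tree of depth `ℓ` as the number of flows tends to infinity: flow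
sizes are independent with law `ν`, and counters have independent Poisson numbers of other flows. -/
def flowTreeLaw (k : ℕ) (γ : ℝ≥0) (ν : PMF ℕ) : (ℓ : ℕ) → PMF (FlowTree k ℓ)
  | 0 => ν
  | ℓ + 1 => ν.bind fun s =>
      (iidFamily ((otherFlows γ).bind (iidList (flowTreeLaw k γ ν ℓ))) (k - 1)).map fun cs => (s, cs)

/-- The law of the list of trees of depth `ℓ` below a counter, seen along one of its edges. -/
def counterLaw (k : ℕ) (γ : ℝ≥0) (ν : PMF ℕ) (ℓ : ℕ) : PMF (List (FlowTree k ℓ)) :=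
  (otherFlows γ).bind (iidList (flowTreeLaw k γ ν ℓ))

/-- The probability `ε` of a flow of size strictly larger than `f_min`. -/
def epsOf (ν : PMF ℕ) (fmin : ℕ) : ℝ := (ν.toOuterMeasure {s | fmin < s}).toReal

/-! ### The residual ensemble on the equivalent graph -/

/-- The shape of a counter node of the equivalent graph, seen along one of its edges: a tree of
depth three. Its root counter has a list of other flows; each of these has `k - 1` further
counters, and the `j`-th of them has `c j` further flows (the leaves of the tree). -/
abbrev CounterTree (k : ℕ) : Type := List (Fin (k - 1) → ℕ)

open Classical in
/-- The peeled equivalent counter node after `2ℓ` iterations of decoding outside the tree: of the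
leaves and of the flows next to the root only those stay whose message is not yet correct, that is,
those which are not peeled. A peeled flow disappears with all its edges; a flow that stays keeps all
its counters. -/
def peel (k fmin ℓ : ℕ) (ts : List (FlowTree k (2 * ℓ + 1))) : CounterTree k :=
  (ts.filter fun t => IsWrong k fmin (2 * ℓ + 1) t).map fun t j =>
    ((Prod.snd t j).filter fun u => IsWrong k fmin (2 * ℓ) u).length

/-- The law of the peeled equivalent counter node below an arbitrary edge. -/
def peeledLaw (k : ℕ) (γ : ℝ≥0) (ν : PMF ℕ) (fmin ℓ : ℕ) : PMF (CounterTree k) :=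
  (counterLaw k γ ν (2 * ℓ + 1)).map (peel k fmin ℓ)

/-- The probability of the shape `T` for the equivalent counter node below an edge of the residual
graph. An edge `(f, c)` stays in the residual graph only if, apart from `f`, some flow of `c`
stays (otherwise `c` has degree one and `f` is peeled): the law is conditioned on this event. -/
def residualProb (k : ℕ) (γ : ℝ≥0) (ν : PMF ℕ) (fmin ℓ : ℕ) (T : CounterTree k) : ℝ :=
  if T = [] then 0
  else (peeledLaw k γ ν fmin ℓ T).toReal / (1 - (peeledLaw k γ ν fmin ℓ []).toReal)

/-- The probability that the message of an equivalent counter node of shape `T` is wrong if the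
messages of its leaves are wrong independently with probability `z`: a counter message is correct
iff all incoming messages are, and the message of an inner flow is wrong iff all incoming ones
are. -/
def treeError {k : ℕ} (T : CounterTree k) (z : ℝ) : ℝ :=
  1 - (T.map fun c => 1 - ∏ j, (1 - (1 - z) ^ c j)).prod

/-- The counter node update of density evolution for an ensemble of equivalent counter nodes whose
shape, seen along a random edge, has law `P`. -/
def counterUpdate {k : ℕ} (P : PMF (CounterTree k)) (z : ℝ) : ℝ :=
  ∑' T, (P T).toReal * treeError T z

/-- `P` is the law of the equivalent counter node below an edge of the expected residual graph when
the decoder stops: the limit of the residual laws as the number of iterations grows. -/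
def IsResidualEnsemble (k : ℕ) (γ : ℝ≥0) (ν : PMF ℕ) (fmin : ℕ) (P : PMF (CounterTree k)) : Prop :=
  ∀ T, Tendsto (fun ℓ => residualProb k γ ν fmin ℓ T) atTop (𝓝 (P T).toReal)

end CounterBraid

end

noncomputable section

namespace CounterBraid

/-! ### The area under an EBP EXIT curve -/

/-! Area. For a `C¹` update `G`, the powers of `G` cancel in `h dε`: it equals `(G - (k-1) z G')
dz`, with primitive `Φ_G(z) = k ∫₀ᶻ G - (k-1) z G(z)` (`trialEntropy`), zero at `0`. The area
condition at `x*` therefore says `Φ_g(x*) = 0`. For `u > 0` the fixed point equation is `ε = ε(u)`,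
so the condition that `ε(x*)` is not attained to the right of `x*` forces `x*` to be the largest
fixed point (`isAreaThreshold_iff_of_isLargestFixedPoint`). The residual update is `z ↦ g(xz)/g(x)`,
a rescaling of `g`; substituting `u = xz` gives its area as `Φ_g(x)/(x g(x))` (`residualArea`),
which vanishes exactly with `Φ_g(x)`.

Residual ensemble. BP messages bound the sizes from alternating sides, so errors at a counter cannot
cancel and an odd message is wrong iff each of its counters receives a wrong message. Wrong messages
form a thinned Poisson family, whence the error probabilities obey `x ↦ f(g(x); ε)` from the start
`ε` and decrease to the largest fixed point (`tendsto_wrongProb`). The same thinning gives the exact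
law of the peeled tree after `2ℓ` iterations (`peeledLaw_apply`), continuous in the error
probability, so the limit exists. The exponential formula sums the tree errors to `g(xz)`
(`hasSum_treeWeight_mul`); the empty tree has mass `1 - g(x)` and error `0`, so conditioning on
nonempty trees only divides by `g(x)`. -/

theorem rho_eq_exp (γ z : ℝ) : rho γ z = Real.exp (-(γ * (1 - z))) := by
  have h := (NormedSpace.expSeries_div_hasSum_exp (𝔸 := ℝ) (γ * z)).mul_left (Real.exp (-γ))
  rw [rho]
  simp_rw [mul_div_assoc]
  rw [h.tsum_eq, ← Real.exp_eq_exp_ℝ, ← Real.exp_add]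
  ring_nf

theorem g_eq_exp (k : ℕ) (γ x : ℝ) :
    g k γ x = 1 - Real.exp (-(γ * (1 - Real.exp (-(γ * x))) ^ (k - 1))) := by
  simp only [g, rho_eq_exp, sub_sub_cancel]

theorem g_lt_one (k : ℕ) (γ x : ℝ) : g k γ x < 1 := by
  rw [g_eq_exp]
  linarith [Real.exp_pos (-(γ * (1 - Real.exp (-(γ * x))) ^ (k - 1)))]

theorem one_sub_exp_nonneg {γ x : ℝ} (hγ : 0 ≤ γ) (hx : 0 ≤ x) :
    0 ≤ 1 - Real.exp (-(γ * x)) := by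
  have : Real.exp (-(γ * x)) ≤ 1 := Real.exp_le_one_iff.2 (by nlinarith)
  linarith

theorem g_pos (k : ℕ) {γ x : ℝ} (hγ : 0 < γ) (hx : 0 < x) : 0 < g k γ x := by
  have h : Real.exp (-(γ * x)) < 1 := Real.exp_lt_one_iff.2 (by nlinarith)
  have h' : 0 < γ * (1 - Real.exp (-(γ * x))) ^ (k - 1) :=
    mul_pos hγ (pow_pos (by linarith) _)
  have : Real.exp (-(γ * (1 - Real.exp (-(γ * x))) ^ (k - 1))) < 1 :=
    Real.exp_lt_one_iff.2 (by linarith)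
  rw [g_eq_exp]
  linarith

theorem g_mono (k : ℕ) {γ x y : ℝ} (hγ : 0 ≤ γ) (hx : 0 ≤ x) (hxy : x ≤ y) :
    g k γ x ≤ g k γ y := by
  have h0 := one_sub_exp_nonneg hγ hx
  rw [g_eq_exp, g_eq_exp]
  gcongr

theorem g_nonneg (k : ℕ) {γ x : ℝ} (hγ : 0 ≤ γ) (hx : 0 ≤ x) : 0 ≤ g k γ x := by
  have h0 := one_sub_exp_nonneg hγ hx
  rw [g_eq_exp]
  have : Real.exp (-(γ * (1 - Real.exp (-(γ * x))) ^ (k - 1))) ≤ 1 :=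
    Real.exp_le_one_iff.2 (by have := mul_nonneg hγ (pow_nonneg h0 (k - 1)); linarith)
  linarith

theorem contDiff_g (k : ℕ) (γ : ℝ) : ContDiff ℝ 1 (g k γ) := by
  have : g k γ = fun x => 1 - Real.exp (-(γ * (1 - Real.exp (-(γ * x))) ^ (k - 1))) :=
    funext (g_eq_exp k γ)
  rw [this]
  fun_prop

theorem continuous_g (k : ℕ) (γ : ℝ) : Continuous (g k γ) := (contDiff_g k γ).continuous

/-- The primitive of `h dε` along the EBP EXIT curve of an ensemble with counter node update `G`. -/
def trialEntropy (k : ℕ) (G : ℝ → ℝ) (x : ℝ) : ℝ :=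
  k * (∫ u in (0 : ℝ)..x, G u) - (k - 1) * (x * G x)

theorem hasDerivAt_trialEntropy (k : ℕ) {G : ℝ → ℝ} (hG : ContDiff ℝ 1 G) (x : ℝ) :
    HasDerivAt (trialEntropy k G) (G x - (k - 1) * (x * deriv G x)) x := by
  have h1 : HasDerivAt (fun x => ∫ u in (0 : ℝ)..x, G u) (G x) x :=
    intervalIntegral.integral_hasDerivAt_right (hG.continuous.intervalIntegrable _ _)
      (hG.continuous.stronglyMeasurableAtFilter _ _) hG.continuous.continuousAt
  have h2 : HasDerivAt G (deriv G x) x := (hG.differentiable one_ne_zero x).hasDerivAt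
  have := (h1.const_mul (k : ℝ)).sub (((hasDerivAt_id x).mul h2).const_mul ((k : ℝ) - 1))
  refine this.congr_deriv ?_
  simp only [id]
  ring

/-- The quotient rule puts `G ^ k` in the denominator, which `ebpH` cancels. The right side is
continuous even where `G` vanishes and `ebpEps` is `0 / 0`. -/
theorem ebpH_mul_deriv_ebpEps {k : ℕ} (hk : 2 ≤ k) {G : ℝ → ℝ} (hG : ContDiff ℝ 1 G) {x : ℝ}
    (hx : G x ≠ 0) :
    ebpH k G x * deriv (ebpEps k G) x = G x - (k - 1) * (x * deriv G x) := by
  obtain ⟨m, rfl⟩ : ∃ m, k = m + 2 := ⟨k - 2, by omega⟩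
  have h2 : HasDerivAt G (deriv G x) x := (hG.differentiable one_ne_zero x).hasDerivAt
  have h3 : HasDerivAt (ebpEps (m + 2) G) _ x :=
    (hasDerivAt_id x).div (h2.pow (m + 2 - 1)) (pow_ne_zero _ hx)
  rw [h3.deriv, ebpH]
  simp only [id, Nat.add_sub_cancel, show m + 2 - 1 = m + 1 by omega]
  push_cast
  field_simp
  ring

theorem ebpArea {k : ℕ} (hk : 2 ≤ k) {G : ℝ → ℝ} (hG : ContDiff ℝ 1 G)
    (hpos : ∀ x, 0 < x → G x ≠ 0) {a b : ℝ} (ha : 0 ≤ a) (hab : a ≤ b) :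
    IntervalIntegrable (fun x => ebpH k G x * deriv (ebpEps k G) x) volume a b ∧
      ∫ x in a..b, ebpH k G x * deriv (ebpEps k G) x = trialEntropy k G b - trialEntropy k G a := by
  have hc : Continuous fun x => G x - (k - 1) * (x * deriv G x) := by
    have := hG.continuous
    have := hG.continuous_deriv le_rfl
    fun_prop
  -- Equality on the half-open interval suffices for the integral, so the possible zero of `G` at `a
  -- = 0` does no harm.
  have hEq : Set.EqOn (fun x => G x - (k - 1) * (x * deriv G x))
      (fun x => ebpH k G x * deriv (ebpEps k G) x) (Set.uIoc a b) := by
    intro x hx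
    rw [Set.uIoc_of_le hab] at hx
    exact (ebpH_mul_deriv_ebpEps hk hG (hpos x (ha.trans_lt hx.1))).symm
  have hi := hc.intervalIntegrable (μ := volume) a b
  refine ⟨hi.congr hEq, ?_⟩
  rw [← intervalIntegral.integral_eq_sub_of_hasDerivAt
    (fun x _ => hasDerivAt_trialEntropy k hG x) hi]
  exact intervalIntegral.integral_congr_ae (ae_of_all _ fun x hx => (hEq hx).symm)

theorem trialEntropy_zero (k : ℕ) (G : ℝ → ℝ) : trialEntropy k G 0 = 0 := by
  simp [trialEntropy]

/-- The residual counter node update as a rescaling of `g`. -/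
theorem one_sub_rhoTilde (k : ℕ) (γ x z : ℝ) :
    1 - rhoTilde k γ x (1 - z) = g k γ (x * z) / g k γ x := by
  rw [rhoTilde, sub_sub_cancel]
  ring_nf

theorem epsTilde_eq (k : ℕ) (γ x : ℝ) :
    epsTilde k γ x = ebpEps k fun z => g k γ (x * z) / g k γ x := by
  funext z
  rw [epsTilde, ebpEps, one_sub_rhoTilde]

theorem hTilde_eq (k : ℕ) (γ x : ℝ) :
    hTilde k γ x = ebpH k fun z => g k γ (x * z) / g k γ x := by
  funext z
  rw [hTilde, ebpH, one_sub_rhoTilde]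

/-- The substitution `u = x z` scales both terms of `trialEntropy` by the same factor. -/
theorem trialEntropy_rescaled (k : ℕ) (γ : ℝ) {x : ℝ} (hx : x ≠ 0) :
    trialEntropy k (fun z => g k γ (x * z) / g k γ x) 1 =
      trialEntropy k (g k γ) x / (x * g k γ x) := by
  have h : ∫ u in (0 : ℝ)..1, g k γ (x * u) = x⁻¹ * ∫ u in (0 : ℝ)..x, g k γ u := by
    rw [intervalIntegral.integral_comp_mul_left _ hx]
    simp
  simp only [trialEntropy, intervalIntegral.integral_div, h, mul_one, one_mul]
  rcases eq_or_ne (g k γ x) 0 with h0 | h0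
  · simp [h0]
  · field_simp

theorem residualArea {k : ℕ} (hk : 2 ≤ k) {γ x : ℝ} (hγ : 0 < γ) (hx : 0 < x) :
    IntervalIntegrable (fun z => hTilde k γ x z * deriv (epsTilde k γ x) z) volume 0 1 ∧
      ∫ z in (0 : ℝ)..1, hTilde k γ x z * deriv (epsTilde k γ x) z =
        trialEntropy k (g k γ) x / (x * g k γ x) := by
  have hG : ContDiff ℝ 1 fun z => g k γ (x * z) / g k γ x :=
    ((contDiff_g k γ).comp (contDiff_const.mul contDiff_id)).div_const _
  have := ebpArea hk hG
    (fun z hz => (div_pos (g_pos k hγ (mul_pos hx hz)) (g_pos k hγ hx)).ne') le_rfl zero_le_one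
  rw [epsTilde_eq, hTilde_eq]
  rwa [trialEntropy_rescaled k γ hx.ne', trialEntropy_zero, sub_zero] at this

/-! ### Area thresholds and the largest fixed point -/

theorem isAreaThreshold_iff {k : ℕ} (hk : 2 ≤ k) {γ ε : ℝ} (hγ : 0 < γ) :
    IsAreaThreshold k γ ε ↔ ∃ xs ∈ Set.Ioc (0 : ℝ) 1, trialEntropy k (g k γ) xs = 0 ∧
      (∀ x' ∈ Set.Ioc xs 1, ebpEps k (g k γ) x' ≠ ebpEps k (g k γ) xs) ∧
      ε = ebpEps k (g k γ) xs := by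
  refine exists_congr fun xs => and_congr_right fun hxs => and_congr_left fun _ => ?_
  have hpos : ∀ x, 0 < x → g k γ x ≠ 0 := fun x hx => (g_pos k hγ hx).ne'
  -- The areas from `xs` and from `0` differ by the value of `trialEntropy` at `xs`.
  rw [(ebpArea hk (contDiff_g k γ) hpos hxs.1.le hxs.2).2,
    (ebpArea hk (contDiff_g k γ) hpos le_rfl zero_le_one).2, trialEntropy_zero]
  constructor <;> intro h <;> linarith

theorem eq_f_iff {k : ℕ} {γ ε u : ℝ} (hγ : 0 < γ) (hu : 0 < u) :
    u = f k ε (g k γ u) ↔ ε = ebpEps k (g k γ) u := by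
  have := (pow_pos (g_pos k hγ hu) (k - 1)).ne'
  rw [f, ebpEps, eq_div_iff this, eq_comm]

/-- Positive fixed points for `ε` are the parameters `u` with `ε(u) = ε`. Having no such parameter
to the right of `xs` is the same as `xs` being the largest fixed point. -/
theorem isAreaThreshold_iff_of_isLargestFixedPoint {k : ℕ} (hk : 2 ≤ k) {γ ε x : ℝ} (hγ : 0 < γ)
    (hx : IsLargestFixedPoint k γ ε x) :
    IsAreaThreshold k γ ε ↔ 0 < x ∧ trialEntropy k (g k γ) x = 0 := by
  rw [isAreaThreshold_iff hk hγ]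
  obtain ⟨⟨⟨hx0, hx1⟩, hfix⟩, hub⟩ := hx
  constructor
  · rintro ⟨xs, hxs, hΦ, hne, he⟩
    have hle : xs ≤ x := hub ⟨⟨hxs.1.le, hxs.2⟩, (eq_f_iff hγ hxs.1).2 he⟩
    have hpos := hxs.1.trans_le hle
    have : xs = x := by
      refine hle.eq_of_not_lt fun hlt => hne x ⟨hlt, hx1⟩ ?_
      rw [← he, ← (eq_f_iff hγ hpos).1 hfix]
    exact this ▸ ⟨hxs.1, hΦ⟩
  · rintro ⟨hpos, hΦ⟩
    have he := (eq_f_iff hγ hpos).1 hfix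
    refine ⟨x, ⟨hpos, hx1⟩, hΦ, fun x' hx' h => ?_, he⟩
    have h0 := hpos.trans hx'.1
    exact hx'.1.not_ge (hub ⟨⟨h0.le, hx'.2⟩, (eq_f_iff hγ h0).2 (he.trans h.symm)⟩)

/-! ### Sums over tuples and lists -/

theorem tsum_prod_tuple {α : Type} (w : α → ℝ≥0∞) :
    ∀ n : ℕ, ∑' v : Fin n → α, ∏ i, w (v i) = (∑' a, w a) ^ n
  | 0 => by simp [tsum_fintype]
  | n + 1 => by
    rw [← (Fin.consEquiv fun _ : Fin (n + 1) => α).tsum_eq, ENNReal.tsum_prod']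
    simp only [Fin.consEquiv, Equiv.coe_fn_mk, Fin.prod_univ_succ, Fin.cons_zero, Fin.cons_succ,
      ENNReal.tsum_mul_left, ENNReal.tsum_mul_right, tsum_prod_tuple w n, pow_succ']

/-- Lets nonnegative sums over tuples and lists be rearranged in `ℝ≥0∞`, where summability is
automatic, and then brought back to `ℝ`. -/
theorem hasSum_of_tsum_ofReal {α : Type} {F : α → ℝ} {S : ℝ} (hF : ∀ a, 0 ≤ F a) (hS : 0 ≤ S)
    (h : ∑' a, ENNReal.ofReal (F a) = ENNReal.ofReal S) : HasSum F S := by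
  have hs : Summable F := by
    have := ENNReal.summable_toReal (f := fun a => ENNReal.ofReal (F a)) (by simp [h])
    simpa [ENNReal.toReal_ofReal (hF _)] using this
  rw [← ENNReal.ofReal_tsum_of_nonneg hF hs,
    ENNReal.ofReal_eq_ofReal_iff (tsum_nonneg hF) hS] at h
  exact h ▸ hs.hasSum

theorem tsum_ofReal_of_hasSum {α : Type} {F : α → ℝ} {S : ℝ} (hF : ∀ a, 0 ≤ F a)
    (h : HasSum F S) : ∑' a, ENNReal.ofReal (F a) = ENNReal.ofReal S := by
  rw [← ENNReal.ofReal_tsum_of_nonneg hF h.summable, h.tsum_eq]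

theorem hasSum_prod_tuple {α : Type} {w : α → ℝ} {S : ℝ} (hw : ∀ a, 0 ≤ w a) (h : HasSum w S)
    (n : ℕ) : HasSum (fun v : Fin n → α => ∏ i, w (v i)) (S ^ n) := by
  have hS : 0 ≤ S := h.nonneg hw
  refine hasSum_of_tsum_ofReal (fun v => Finset.prod_nonneg fun i _ => hw _) (pow_nonneg hS n) ?_
  simp_rw [ENNReal.ofReal_prod_of_nonneg (fun i _ => hw _)]
  rw [tsum_prod_tuple (fun a => ENNReal.ofReal (w a)), tsum_ofReal_of_hasSum hw h,
    ENNReal.ofReal_pow hS]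

theorem tsum_list {α : Type} (F : List α → ℝ≥0∞) :
    ∑' l, F l = ∑' n : ℕ, ∑' v : Fin n → α, F (List.ofFn v) := by
  rw [← List.equivSigmaTuple.symm.tsum_eq, ENNReal.tsum_sigma']
  rfl

/-- The exponential formula for sequences. -/
theorem hasSum_list_exp {α : Type} {a : α → ℝ} {A lam : ℝ} (ha : ∀ c, 0 ≤ a c) (hlam : 0 ≤ lam)
    (h : HasSum a A) :
    HasSum (fun T : List α => lam ^ T.length / (T.length.factorial : ℝ) * (T.map a).prod)
      (Real.exp (lam * A)) := by
  have hA : 0 ≤ A := h.nonneg ha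
  have hprod : ∀ T : List α, 0 ≤ (T.map a).prod := fun T =>
    List.prod_nonneg (by simp only [List.mem_map]; rintro _ ⟨c, -, rfl⟩; exact ha c)
  refine hasSum_of_tsum_ofReal (fun T => mul_nonneg (by positivity) (hprod T))
    (Real.exp_pos _).le ?_
  rw [tsum_list]
  have hexp : HasSum (fun n : ℕ => lam ^ n / (n.factorial : ℝ) * A ^ n) (Real.exp (lam * A)) := by
    have := NormedSpace.expSeries_div_hasSum_exp (𝔸 := ℝ) (lam * A)
    rw [← Real.exp_eq_exp_ℝ] at this
    simpa [mul_pow, mul_div_right_comm] using this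
  rw [← tsum_ofReal_of_hasSum (fun n => by positivity) hexp]
  refine tsum_congr fun n => ?_
  refine tsum_ofReal_of_hasSum (fun v => mul_nonneg (by positivity) (hprod _)) ?_
  simp only [List.length_ofFn, List.map_ofFn, List.prod_ofFn, Function.comp]
  exact (hasSum_prod_tuple ha h n).mul_left _

/-! ### Independent families -/

theorem iidFamily_apply {α : Type} (p : PMF α) :
    ∀ (n : ℕ) (v : Fin n → α), iidFamily p n v = ∏ i, p (v i)
  | 0, v => by
    rw [iidFamily, PMF.pure_apply, if_pos (Subsingleton.elim _ _)]
    simp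
  | n + 1, v => by
    classical
    rw [iidFamily, PMF.bind_apply, tsum_eq_single (v 0), PMF.map_apply,
      tsum_eq_single (Fin.tail v), if_pos (Fin.cons_self_tail v).symm, iidFamily_apply p n,
      Fin.prod_univ_succ]
    · rfl
    · intro w hw
      rw [if_neg]
      intro h
      exact hw (by rw [h, Fin.tail_cons])
    · intro a ha
      rw [PMF.map_apply, mul_eq_zero]
      right
      refine ENNReal.tsum_eq_zero.2 fun w => if_neg fun h => ha ?_
      rw [h]
      rfl

theorem iidFamily_map {α β : Type} (p : PMF α) (φ : α → β) :
    ∀ n : ℕ, (iidFamily p n).map (fun v j => φ (v j)) = iidFamily (p.map φ) n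
  | 0 => by
    simp only [iidFamily, PMF.pure_map]
    congr 1
    exact Subsingleton.elim _ _
  | n + 1 => by
    simp only [iidFamily, PMF.map_bind, PMF.bind_map, PMF.map_comp, ← iidFamily_map p φ n]
    congr 1
    funext a
    simp only [Function.comp_apply]
    congr 1
    funext v
    funext j
    refine Fin.cases ?_ (fun i => ?_) j <;> simp

theorem iidList_map {α β : Type} (p : PMF α) (φ : α → β) :
    ∀ n : ℕ, (iidList p n).map (List.map φ) = iidList (p.map φ) n
  | 0 => by simp [iidList, PMF.pure_map]
  | n + 1 => by
    simp only [iidList, PMF.map_bind, PMF.bind_map, PMF.map_comp, ← iidList_map p φ n]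
    rfl

theorem map_cons_apply_cons {β : Type} (q : PMF (List β)) (b c : β) (T : List β) [DecidableEq β] :
    (q.map fun l => b :: l) (c :: T) = if b = c then q T else 0 := by
  rw [PMF.map_apply, tsum_eq_single T]
  · by_cases h : b = c <;> simp [h, eq_comm]
  · intro l hl
    rw [if_neg]
    rintro h
    exact hl (List.cons.inj h).2.symm

theorem tsum_option {β : Type} (F : Option β → ℝ≥0∞) :
    ∑' o, F o = F none + ∑' b, F (some b) := by
  rw [← (Equiv.optionEquivSumPUnit.{0} β).symm.tsum_eq,
    Summable.tsum_sum ENNReal.summable ENNReal.summable]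
  simp [add_comm]

/-- Conditioning on the first sample: it is either dropped or becomes the head. -/
theorem iidList_reduceOption_succ {β : Type} (p : PMF (Option β)) (n : ℕ) (T : List β) :
    (iidList p (n + 1)).map List.reduceOption T =
      p none * (iidList p n).map List.reduceOption T +
        ∑' b, p (some b) * (((iidList p n).map List.reduceOption).map fun l => b :: l) T := by
  simp only [iidList, PMF.map_bind, PMF.map_comp, PMF.bind_apply, tsum_option]
  rfl

/-- The law of the sublist of the samples which are not `none`. -/
theorem iidList_reduceOption_apply {β : Type} (p : PMF (Option β)) :
    ∀ (n : ℕ) (T : List β), (iidList p n).map List.reduceOption T =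
      (n.choose T.length : ℝ≥0∞) * p none ^ (n - T.length) * (T.map fun b => p (some b)).prod
  | 0, [] => by simp [iidList, PMF.pure_map]
  | 0, b :: T => by simp [iidList, PMF.pure_map]
  | n + 1, [] => by
    rw [iidList_reduceOption_succ, iidList_reduceOption_apply p n]
    simp [pow_succ']
  | n + 1, c :: T => by
    classical
    rw [iidList_reduceOption_succ, tsum_eq_single c, map_cons_apply_cons, if_pos rfl,
      iidList_reduceOption_apply p n, iidList_reduceOption_apply p n]
    · simp only [List.length_cons, List.map_cons, List.prod_cons, Nat.choose_succ_succ,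
        Nat.cast_add, Nat.add_sub_add_right]
      -- The Pascal recursion needs one factor `p none` split off, which requires `T.length < n`.
      -- Otherwise the subtraction truncates, but the binomial coefficient multiplying that term is
      -- zero.
      rcases lt_or_ge T.length n with h | h
      · obtain ⟨m, hm⟩ : ∃ m, n - T.length = m + 1 := ⟨n - T.length - 1, by omega⟩
        rw [hm, show n - (T.length + 1) = m by omega]
        ring
      · rw [Nat.choose_eq_zero_of_lt (show n < T.length.succ by omega)]
        simp
        ring
    · intro b hb
      rw [map_cons_apply_cons, if_neg hb, mul_zero]

/-! ### Poisson numbers of samples -/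

/-- The probability of `n` under the Poisson law of mean `r`. -/
def poissonWeight (r : ℝ) (n : ℕ) : ℝ := Real.exp (-r) * r ^ n / (n.factorial : ℝ)

theorem poissonWeight_nonneg {r : ℝ} (hr : 0 ≤ r) (n : ℕ) : 0 ≤ poissonWeight r n := by
  unfold poissonWeight; positivity

theorem otherFlows_apply (γ : ℝ≥0) (n : ℕ) :
    otherFlows γ n = ENNReal.ofReal (poissonWeight γ n) :=
  poissonMeasure_singleton γ n

theorem hasSum_poissonWeight_mul_pow (r s : ℝ) :
    HasSum (fun n => poissonWeight r n * s ^ n) (Real.exp (-(r * (1 - s)))) := by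
  have h := (NormedSpace.expSeries_div_hasSum_exp (𝔸 := ℝ) (r * s)).mul_left (Real.exp (-r))
  rw [← Real.exp_eq_exp_ℝ, ← Real.exp_add] at h
  have e : (fun n => poissonWeight r n * s ^ n) =
      fun n : ℕ => Real.exp (-r) * ((r * s) ^ n / (n.factorial : ℝ)) := by
    funext n
    simp only [poissonWeight, mul_pow]
    ring
  rwa [e, show -(r * (1 - s)) = -r + r * s by ring]

/-- Terms with `n < m` vanish. After shifting by `m`, `C(n+m, m) / (n+m)! = 1 / (n! m!)` leaves the
generating function times `r ^ m / m!`. -/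
theorem hasSum_poissonWeight_mul_choose (r s : ℝ) (m : ℕ) :
    HasSum (fun n => poissonWeight r n * ((n.choose m : ℝ) * s ^ (n - m)))
      (Real.exp (-(r * (1 - s))) * r ^ m / (m.factorial : ℝ)) := by
  rw [← (hasSum_nat_add_iff' m)]
  have hz : ∑ i ∈ Finset.range m, poissonWeight r i * ((i.choose m : ℝ) * s ^ (i - m)) = 0 :=
    Finset.sum_eq_zero fun i hi => by
      rw [Nat.choose_eq_zero_of_lt (Finset.mem_range.1 hi)]; simp
  rw [hz, sub_zero]
  have e : (fun n => poissonWeight r (n + m) * (((n + m).choose m : ℝ) * s ^ (n + m - m))) =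
      fun n => poissonWeight r n * s ^ n * (r ^ m / (m.factorial : ℝ)) := by
    funext n
    have h1 : (((n + m).choose m : ℕ) : ℝ) * (n.factorial * m.factorial) = (n + m).factorial := by
      rw [← mul_assoc]
      exact_mod_cast Nat.add_choose_mul_factorial_mul_factorial n m
    have h2 : (((n + m).choose m : ℕ) : ℝ) ≠ 0 :=
      Nat.cast_ne_zero.2 (Nat.choose_pos (Nat.le_add_left m n)).ne'
    have h3 : (n.factorial : ℝ) ≠ 0 := by positivity
    have h4 : (m.factorial : ℝ) ≠ 0 := by positivity
    simp only [Nat.add_sub_cancel, poissonWeight, ← h1]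
    field_simp
    ring
  rw [e, mul_div_assoc]
  exact (hasSum_poissonWeight_mul_pow r s).mul_right _

/-- Poisson thinning: the law of the samples which are not `none`, in a list of a Poisson number of
independent samples. -/
theorem bind_iidList_reduceOption_apply {β : Type} (γ : ℝ≥0) (p : PMF (Option β)) (T : List β) :
    ((otherFlows γ).bind (iidList p)).map List.reduceOption T =
      ENNReal.ofReal (Real.exp (-(γ * (1 - (p none).toReal))) * γ ^ T.length /
        (T.length.factorial : ℝ)) * (T.map fun b => p (some b)).prod := by
  rw [PMF.map_bind, PMF.bind_apply,
    ← tsum_ofReal_of_hasSum _ (hasSum_poissonWeight_mul_choose γ (p none).toReal T.length),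
    ← ENNReal.tsum_mul_right]
  · refine tsum_congr fun n => ?_
    rw [iidList_reduceOption_apply, otherFlows_apply, ENNReal.ofReal_mul
      (poissonWeight_nonneg γ.coe_nonneg n), ENNReal.ofReal_mul (by positivity),
      ENNReal.ofReal_natCast, ENNReal.ofReal_pow ENNReal.toReal_nonneg, ENNReal.ofReal_toReal (p.apply_ne_top _)]
    ring
  · intro n
    exact mul_nonneg (poissonWeight_nonneg γ.coe_nonneg n) (by positivity)

theorem bind_iidList_filterMap_apply {α β : Type} (γ : ℝ≥0) (p : PMF α) (φ : α → Option β)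
    (T : List β) :
    ((otherFlows γ).bind (iidList p)).map (List.filterMap φ) T =
      ENNReal.ofReal (Real.exp (-(γ * (1 - (p.map φ none).toReal))) * γ ^ T.length /
        (T.length.factorial : ℝ)) * (T.map fun b => p.map φ (some b)).prod := by
  rw [← bind_iidList_reduceOption_apply]
  congr 1
  simp only [PMF.map_bind, ← iidList_map, PMF.map_comp]
  congr 1
  funext n
  congr 1
  funext l
  simp [List.reduceOption, List.filterMap_map]

/-! ### Monotonicity of the BP messages -/

/-- All flows of the tree have size at least `fmin`. -/
def SizesGE (k fmin : ℕ) : (ℓ : ℕ) → FlowTree k ℓ → Prop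
  | 0, s => fmin ≤ (show ℕ from s)
  | ℓ + 1, (s, cs) => fmin ≤ s ∧ ∀ j, ∀ u ∈ cs j, SizesGE k fmin ℓ u

/-- One-sided bounds exclude cancellation: sums of termwise ordered lists agree only if all terms
do. Hence a counter cannot be right by accident. -/
theorem list_sum_eq_iff {α : Type} {a b : α → ℤ} : ∀ {l : List α}, (∀ u ∈ l, a u ≤ b u) →
    ((l.map a).sum ≤ (l.map b).sum ∧ ((l.map a).sum = (l.map b).sum ↔ ∀ u ∈ l, a u = b u))
  | [], _ => by simp
  | u :: l, h => by
    have h1 := h u (by simp)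
    obtain ⟨h2, h3⟩ := list_sum_eq_iff (l := l) fun v hv => h v (by simp [hv])
    simp only [List.map_cons, List.sum_cons, List.forall_mem_cons, ← h3]
    omega

/-- The tree with root of size `s` and subtrees `cs`. -/
def node {k ℓ : ℕ} (s : ℕ) (cs : Fin (k - 1) → List (FlowTree k ℓ)) : FlowTree k (ℓ + 1) := (s, cs)

/-- The size of the flow at the root, as a natural number. -/
def rootFlow {k ℓ : ℕ} (t : FlowTree k (ℓ + 1)) : ℕ := Prod.fst t

open Classical in
/-- The number of wrong messages coming into a counter. -/
def wrongNumber (k fmin ℓ : ℕ) (us : List (FlowTree k ℓ)) : ℕ :=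
  (us.filter fun u => IsWrong k fmin ℓ u).length

/-- The number of wrong messages coming into each counter next to the root. -/
def wrongCount (k fmin ℓ : ℕ) (t : FlowTree k (ℓ + 1)) (j : Fin (k - 1)) : ℕ :=
  wrongNumber k fmin ℓ (Prod.snd t j)

theorem wrongCount_eq_zero {k fmin ℓ s : ℕ} {cs : Fin (k - 1) → List (FlowTree k ℓ)}
    {j : Fin (k - 1)} :
    wrongCount k fmin ℓ (s, cs) j = 0 ↔ ∀ u ∈ cs j, bpMessage k fmin ℓ u = rootSize k ℓ u := by
  change wrongNumber k fmin ℓ (cs j) = 0 ↔ _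
  rw [wrongNumber, List.length_eq_zero_iff, List.filter_eq_nil_iff]
  refine forall₂_congr fun u _ => ?_
  exact (not_congr (@decide_eq_true_iff _ (Classical.propDecidable _))).trans not_not

/-- The message of counter `j` to the root. -/
def counterMessage (k fmin ℓ s : ℕ) (us : List (FlowTree k ℓ)) : ℤ :=
  max (((s : ℤ) + (us.map (rootSize k ℓ)).sum) - (us.map (bpMessage k fmin ℓ)).sum) (fmin : ℤ)

theorem bpMessage_succ (k fmin ℓ s : ℕ) (cs : Fin (k - 1) → List (FlowTree k ℓ)) :
    bpMessage k fmin (ℓ + 1) (s, cs) =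
      if Odd (ℓ + 1) then ⨅ j, counterMessage k fmin ℓ s (cs j)
      else ⨆ j, counterMessage k fmin ℓ s (cs j) := rfl

theorem bpMessage_bounds_and_isWrong_iff_odd {k fmin ℓ s : ℕ} (hk : 2 ≤ k) (hl : Even ℓ)
    {cs : Fin (k - 1) → List (FlowTree k ℓ)} (hs : fmin ≤ s)
    (h : ∀ j, ∀ u ∈ cs j, bpMessage k fmin ℓ u ≤ rootSize k ℓ u) :
    (s : ℤ) ≤ bpMessage k fmin (ℓ + 1) (s, cs) ∧
      (IsWrong k fmin (ℓ + 1) (s, cs) ↔ ∀ j, wrongCount k fmin ℓ (s, cs) j ≠ 0) := by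
  have : NeZero (k - 1) := ⟨by omega⟩
  have hm : ∀ j, (s : ℤ) ≤ counterMessage k fmin ℓ s (cs j) ∧
      (counterMessage k fmin ℓ s (cs j) = s ↔ wrongCount k fmin ℓ (s, cs) j = 0) := by
    intro j
    obtain ⟨h1, h2⟩ := list_sum_eq_iff (h j)
    -- Incoming messages are too small, so the difference is at least `s ≥ fmin` and the clamp at
    -- `fmin` is inactive.
    rw [wrongCount_eq_zero, ← h2, counterMessage]
    omega
  -- The minimum is attained because `k - 1 > 0`; it equals `s` as soon as one counter is free of
  -- wrong messages.
  obtain ⟨i, hi⟩ := exists_eq_ciInf_of_finite (f := fun j => counterMessage k fmin ℓ s (cs j))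
  have hle : ∀ j, bpMessage k fmin (ℓ + 1) (s, cs) ≤ counterMessage k fmin ℓ s (cs j) := by
    rw [bpMessage_succ, if_pos hl.add_one]
    exact fun j => ciInf_le (Set.finite_range _).bddBelow j
  have hb : bpMessage k fmin (ℓ + 1) (s, cs) = counterMessage k fmin ℓ s (cs i) := by
    rw [bpMessage_succ, if_pos hl.add_one, ← hi]
  refine ⟨hb ▸ (hm i).1, ?_⟩
  change bpMessage k fmin (ℓ + 1) (s, cs) ≠ (s : ℤ) ↔ _
  constructor
  · intro hne j hj
    have h1 := hle j
    rw [(hm j).2.2 hj] at h1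
    exact hne (le_antisymm h1 (hb ▸ (hm i).1))
  · intro hall heq
    exact hall i ((hm i).2.1 (hb ▸ heq))

theorem bpMessage_bounds_and_isWrong_iff_even {k fmin ℓ s : ℕ} (hk : 2 ≤ k) (hl : Odd ℓ)
    {cs : Fin (k - 1) → List (FlowTree k ℓ)} (hs : fmin ≤ s)
    (h : ∀ j, ∀ u ∈ cs j, rootSize k ℓ u ≤ bpMessage k fmin ℓ u) :
    bpMessage k fmin (ℓ + 1) (s, cs) ≤ (s : ℤ) ∧
      (IsWrong k fmin (ℓ + 1) (s, cs) ↔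
        fmin < s ∧ ∀ j, wrongCount k fmin ℓ (s, cs) j ≠ 0) := by
  have : NeZero (k - 1) := ⟨by omega⟩
  have hm : ∀ j, counterMessage k fmin ℓ s (cs j) ≤ (s : ℤ) ∧
      (counterMessage k fmin ℓ s (cs j) = s ↔ ¬ fmin < s ∨ wrongCount k fmin ℓ (s, cs) j = 0) := by
    intro j
    obtain ⟨h1, h2⟩ := list_sum_eq_iff (h j)
    have h3 : (∀ u ∈ cs j, rootSize k ℓ u = bpMessage k fmin ℓ u) ↔
        ∀ u ∈ cs j, bpMessage k fmin ℓ u = rootSize k ℓ u :=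
      forall₂_congr fun _ _ => eq_comm
    -- Here the difference is at most `s`, and the clamp matters: a flow of size `fmin` is always
    -- recovered. This is the source of the factor `ε`.
    rw [wrongCount_eq_zero, ← h3, ← h2, counterMessage]
    omega
  have hodd : ¬ Odd (ℓ + 1) := Nat.not_odd_iff_even.2 hl.add_one
  obtain ⟨i, hi⟩ := exists_eq_ciSup_of_finite (f := fun j => counterMessage k fmin ℓ s (cs j))
  have hle : ∀ j, counterMessage k fmin ℓ s (cs j) ≤ bpMessage k fmin (ℓ + 1) (s, cs) := by
    rw [bpMessage_succ, if_neg hodd]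
    exact fun j => le_ciSup (f := fun j => counterMessage k fmin ℓ s (cs j))
      (Set.finite_range _).bddAbove j
  have hb : bpMessage k fmin (ℓ + 1) (s, cs) = counterMessage k fmin ℓ s (cs i) := by
    rw [bpMessage_succ, if_neg hodd, ← hi]
  refine ⟨hb ▸ (hm i).1, ?_⟩
  change bpMessage k fmin (ℓ + 1) (s, cs) ≠ (s : ℤ) ↔ _
  constructor
  · intro hne
    have key : ∀ j, ¬ (¬ fmin < s ∨ wrongCount k fmin ℓ (s, cs) j = 0) := by
      intro j hj
      have h1 := hle j
      rw [(hm j).2.2 hj] at h1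
      exact hne (le_antisymm (hb ▸ (hm i).1) h1)
    exact ⟨not_not.1 fun h => key i (Or.inl h), fun j hj => key j (Or.inr hj)⟩
  · rintro ⟨hlt, hall⟩ heq
    exact ((hm i).2.1 (hb ▸ heq)).elim (fun h => h hlt) (hall i)

/-- Messages of even iterations are lower bounds of the flow sizes, those of odd iterations are
upper bounds. -/
theorem bpMessage_bounds {k fmin : ℕ} (hk : 2 ≤ k) : ∀ (ℓ : ℕ) (t : FlowTree k ℓ),
    SizesGE k fmin ℓ t → (Even ℓ → bpMessage k fmin ℓ t ≤ rootSize k ℓ t) ∧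
      (Odd ℓ → rootSize k ℓ t ≤ bpMessage k fmin ℓ t)
  | 0, s, h => ⟨fun _ => Int.ofNat_le.2 h, fun h => by simp at h⟩
  | ℓ + 1, (s, cs), h => by
    constructor
    · intro he
      have hl : Odd ℓ := by
        rw [← Nat.not_even_iff_odd]; exact Nat.even_add_one.1 he
      exact (bpMessage_bounds_and_isWrong_iff_even hk hl h.1
        fun j u hu => (bpMessage_bounds hk ℓ u (h.2 j u hu)).2 hl).1
    · intro ho
      have hl : Even ℓ := by
        rw [← Nat.not_odd_iff_even]; exact Nat.odd_add_one.1 ho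
      exact (bpMessage_bounds_and_isWrong_iff_odd hk hl h.1
        fun j u hu => (bpMessage_bounds hk ℓ u (h.2 j u hu)).1 hl).1

theorem isWrong_odd_iff {k fmin ℓ : ℕ} (hk : 2 ≤ k) (hl : Even ℓ) (t : FlowTree k (ℓ + 1))
    (h : SizesGE k fmin (ℓ + 1) t) :
    IsWrong k fmin (ℓ + 1) t ↔ ∀ j, wrongCount k fmin ℓ t j ≠ 0 := by
  obtain ⟨s, cs⟩ := t
  exact (bpMessage_bounds_and_isWrong_iff_odd hk hl h.1
    fun j u hu => (bpMessage_bounds hk ℓ u (h.2 j u hu)).1 hl).2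

theorem isWrong_even_iff {k fmin ℓ : ℕ} (hk : 2 ≤ k) (hl : Odd ℓ) (t : FlowTree k (ℓ + 1))
    (h : SizesGE k fmin (ℓ + 1) t) :
    IsWrong k fmin (ℓ + 1) t ↔ fmin < rootFlow t ∧ ∀ j, wrongCount k fmin ℓ t j ≠ 0 := by
  obtain ⟨s, cs⟩ := t
  exact (bpMessage_bounds_and_isWrong_iff_even hk hl h.1
    fun j u hu => (bpMessage_bounds hk ℓ u (h.2 j u hu)).2 hl).2

/-! ### Supports -/

/-- Needed because the descriptions of wrong messages hold only for trees with all sizes at least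
`fmin`, which are the trees in the support. -/
theorem map_congr_support {α β : Type} {p : PMF α} {φ ψ : α → β}
    (h : ∀ a ∈ p.support, φ a = ψ a) : p.map φ = p.map ψ := by
  classical
  ext b
  simp only [PMF.map_apply]
  refine tsum_congr fun a => ?_
  by_cases ha : a ∈ p.support
  · rw [h a ha]
  · rw [(PMF.apply_eq_zero_iff p a).2 ha, ite_self, ite_self]

theorem mem_support_iidList {α : Type} {p : PMF α} :
    ∀ {n : ℕ} {l : List α}, l ∈ (iidList p n).support → ∀ a ∈ l, a ∈ p.support
  | 0, l, h => by simp [iidList] at h; simp [h]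
  | n + 1, l, h => by
    simp only [iidList, PMF.mem_support_bind_iff, PMF.mem_support_map_iff] at h
    obtain ⟨a, ha, l', hl', rfl⟩ := h
    simp only [List.forall_mem_cons]
    exact ⟨ha, mem_support_iidList hl'⟩

theorem mem_support_iidFamily {α : Type} {p : PMF α} {n : ℕ} {v : Fin n → α}
    (h : v ∈ (iidFamily p n).support) (i : Fin n) : v i ∈ p.support := by
  rw [PMF.mem_support_iff, iidFamily_apply, Finset.prod_ne_zero_iff] at h
  exact h i (Finset.mem_univ i)

theorem flowTreeLaw_succ (k : ℕ) (γ : ℝ≥0) (ν : PMF ℕ) (ℓ : ℕ) :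
    flowTreeLaw k γ ν (ℓ + 1) =
      ν.bind fun s => (iidFamily (counterLaw k γ ν ℓ) (k - 1)).map (node s) := rfl

theorem sizesGE_of_mem_support {k fmin : ℕ} {γ : ℝ≥0} {ν : PMF ℕ}
    (hν : ∀ s ∈ ν.support, fmin ≤ s) :
    ∀ (ℓ : ℕ) (t : FlowTree k ℓ), t ∈ (flowTreeLaw k γ ν ℓ).support → SizesGE k fmin ℓ t
  | 0, s, h => hν s h
  | ℓ + 1, t, h => by
    simp only [flowTreeLaw_succ, PMF.mem_support_bind_iff, PMF.mem_support_map_iff] at h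
    obtain ⟨s, hs, cs, hcs, rfl⟩ := h
    refine ⟨hν s hs, fun j u hu => sizesGE_of_mem_support (γ := γ) hν ℓ u ?_⟩
    obtain ⟨n, -, hn⟩ := (PMF.mem_support_bind_iff _ _ _).1 (mem_support_iidFamily hcs j)
    exact mem_support_iidList hn u hu

/-! ### Density evolution -/

/-- Marks the trees whose message is wrong. -/
def wrongMark (k fmin ℓ : ℕ) (t : FlowTree k ℓ) : Option Unit :=
  open Classical in if IsWrong k fmin ℓ t then some () else none

/-- The probability of a wrong message in iteration `ℓ`. -/
def wrongProb (k : ℕ) (γ : ℝ≥0) (ν : PMF ℕ) (fmin ℓ : ℕ) : ℝ :=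
  ((flowTreeLaw k γ ν ℓ).map (wrongMark k fmin ℓ) (some ())).toReal

theorem wrongProb_nonneg (k : ℕ) (γ : ℝ≥0) (ν : PMF ℕ) (fmin ℓ : ℕ) :
    0 ≤ wrongProb k γ ν fmin ℓ := ENNReal.toReal_nonneg

theorem toReal_none_add_tsum {β : Type} (p : PMF (Option β)) :
    1 - (p none).toReal = (∑' b, p (some b)).toReal := by
  have h := p.tsum_coe
  rw [tsum_option] at h
  have h1 : ∑' b, p (some b) ≠ ∞ := fun h' => by simp [h'] at h
  have := congrArg ENNReal.toReal h
  rw [ENNReal.toReal_add (p.apply_ne_top _) h1, ENNReal.toReal_one] at this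
  linarith

theorem filterMap_wrongMark_length (k fmin ℓ : ℕ) (us : List (FlowTree k ℓ)) :
    (us.filterMap (wrongMark k fmin ℓ)).length = wrongNumber k fmin ℓ us := by
  unfold wrongNumber
  induction us with
  | nil => rfl
  | cons u us ih =>
    by_cases h : IsWrong k fmin ℓ u
    · have hm : wrongMark k fmin ℓ u = some () := if_pos h
      rw [List.filterMap_cons_some hm, List.filter_cons_of_pos (by simpa using h),
        List.length_cons, List.length_cons, ih]
    · have hm : wrongMark k fmin ℓ u = none := if_neg h
      rw [List.filterMap_cons_none hm, List.filter_cons_of_neg (by simpa using h), ih]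

/-- The number of wrong messages coming into a counter has a Poisson law. -/
theorem counterLaw_map_length_apply (k : ℕ) (γ : ℝ≥0) (ν : PMF ℕ) (fmin ℓ m : ℕ) :
    (counterLaw k γ ν ℓ).map (wrongNumber k fmin ℓ) m =
      ENNReal.ofReal (poissonWeight (γ * wrongProb k γ ν fmin ℓ) m) := by
  -- A list over `Unit` is determined by its length, so the law of the length is read off at a
  -- single list.
  have h : ∀ q : PMF (List Unit), q.map List.length m = q (List.replicate m ()) := by
    intro q
    rw [PMF.map_apply, tsum_eq_single (List.replicate m ())]
    · simp
    · intro l hl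
      rw [if_neg]
      rintro rfl
      exact hl (List.eq_replicate_iff.2 ⟨rfl, fun _ _ => rfl⟩)
  have h2 : wrongNumber k fmin ℓ = List.length ∘ List.filterMap (wrongMark k fmin ℓ) :=
    funext fun us => (filterMap_wrongMark_length k fmin ℓ us).symm
  rw [h2, ← PMF.map_comp, h, counterLaw, bind_iidList_filterMap_apply, toReal_none_add_tsum,
    tsum_fintype]
  simp only [List.length_replicate, List.map_replicate, List.prod_replicate, Finset.univ_unique,
    Finset.sum_singleton, PUnit.default_eq_unit]
  rw [← ENNReal.ofReal_toReal (PMF.apply_ne_top (PMF.map _ _) (some ())), ← ENNReal.ofReal_pow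
    ENNReal.toReal_nonneg, ← ENNReal.ofReal_mul (by positivity), ENNReal.toReal_ofReal
    ENNReal.toReal_nonneg]
  congr 1
  rw [poissonWeight, wrongProb, mul_pow]
  ring

/-- The Poisson law of mean `r`, restricted to the positive numbers. -/
def positiveWeight (r : ℝ) (m : ℕ) : ℝ := if m = 0 then 0 else poissonWeight r m

theorem positiveWeight_nonneg {r : ℝ} (hr : 0 ≤ r) (m : ℕ) : 0 ≤ positiveWeight r m := by
  unfold positiveWeight
  split_ifs
  exacts [le_rfl, poissonWeight_nonneg hr m]

/-- The factor `1 - (1 - z) ^ m` vanishes at `m = 0`, so the restriction to positive `m` is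
invisible and the sum is a difference of two Poisson generating functions. -/
theorem hasSum_positiveWeight_mul (r z : ℝ) :
    HasSum (fun m => positiveWeight r m * (1 - (1 - z) ^ m)) (1 - Real.exp (-(r * z))) := by
  have h1 := hasSum_poissonWeight_mul_pow r 1
  have h2 := hasSum_poissonWeight_mul_pow r (1 - z)
  have h3 := h1.sub h2
  rw [sub_self, mul_zero, neg_zero, Real.exp_zero, sub_sub_cancel] at h3
  have e : (fun m => positiveWeight r m * (1 - (1 - z) ^ m)) =
      fun m => poissonWeight r m * 1 ^ m - poissonWeight r m * (1 - z) ^ m := by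
    funext m
    rcases eq_or_ne m 0 with rfl | hm
    · simp [positiveWeight]
    · simp only [positiveWeight, hm, if_false, one_pow]
      ring
  rw [e]
  exact h3

theorem hasSum_positiveWeight (r : ℝ) : HasSum (positiveWeight r) (1 - Real.exp (-r)) := by
  -- At `z = 1`, by `0 ^ 0 = 1`, the factor `1 - 0 ^ m` is the indicator of `m ≠ 0`.
  have h := hasSum_positiveWeight_mul r 1
  have e : (fun m => positiveWeight r m * (1 - (1 - (1 : ℝ)) ^ m)) = positiveWeight r := by
    funext m
    rcases eq_or_ne m 0 with rfl | hm
    · simp [positiveWeight]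
    · simp [hm]
  rwa [e, mul_one] at h

/-- The weight of an inner flow with `c j` residual leaves at its counter `j`. -/
def flowWeight {n : ℕ} (r : ℝ) (c : Fin n → ℕ) : ℝ := ∏ j, positiveWeight r (c j)

theorem flowWeight_nonneg {n : ℕ} {r : ℝ} (hr : 0 ≤ r) (c : Fin n → ℕ) : 0 ≤ flowWeight r c :=
  Finset.prod_nonneg fun j _ => positiveWeight_nonneg hr (c j)

theorem hasSum_flowWeight {r : ℝ} (hr : 0 ≤ r) (n : ℕ) :
    HasSum (fun c : Fin n → ℕ => flowWeight r c) ((1 - Real.exp (-r)) ^ n) :=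
  hasSum_prod_tuple (positiveWeight_nonneg hr) (hasSum_positiveWeight r) n

/-- The event that every counter of a flow is stuck is absorbed into the weights, since
`positiveWeight` is zero at `0`. -/
theorem ite_iidFamily_eq_flowWeight {n : ℕ} {r : ℝ} (hr : 0 ≤ r) {q : PMF ℕ}
    (hq : ∀ m, q m = ENNReal.ofReal (poissonWeight r m)) (c : Fin n → ℕ)
    [Decidable (∀ j, c j ≠ 0)] :
    (if ∀ j, c j ≠ 0 then iidFamily q n c else 0) = ENNReal.ofReal (flowWeight r c) := by
  split_ifs with h
  · rw [iidFamily_apply, flowWeight, ENNReal.ofReal_prod_of_nonneg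
      fun j _ => positiveWeight_nonneg hr _]
    exact Finset.prod_congr rfl fun j _ => by rw [hq, positiveWeight, if_neg (h j)]
  · push Not at h
    obtain ⟨j, hj⟩ := h
    rw [flowWeight, Finset.prod_eq_zero (Finset.mem_univ j) (by rw [positiveWeight, if_pos hj]),
      ENNReal.ofReal_zero]

/-- The law of the size of the root together with the numbers of wrong messages coming into its
counters. -/
theorem flowTreeLaw_map_wrongCount (k : ℕ) (γ : ℝ≥0) (ν : PMF ℕ) (fmin ℓ : ℕ) :
    (flowTreeLaw k γ ν (ℓ + 1)).map (fun t => (rootFlow t, wrongCount k fmin ℓ t)) =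
      ν.bind fun s => (iidFamily ((counterLaw k γ ν ℓ).map (wrongNumber k fmin ℓ)) (k - 1)).map
          fun c => (s, c) := by
  simp only [flowTreeLaw_succ, ← iidFamily_map, PMF.map_bind, PMF.map_comp]
  rfl

/-- The probability that all counters next to the root are stuck. -/
theorem wrongProb_of_isWrong_iff {k : ℕ} {γ : ℝ≥0} {ν : PMF ℕ} {fmin ℓ : ℕ} (S : Set ℕ)
    (h : ∀ t ∈ (flowTreeLaw k γ ν (ℓ + 1)).support,
      (IsWrong k fmin (ℓ + 1) t ↔ rootFlow t ∈ S ∧ ∀ j, wrongCount k fmin ℓ t j ≠ 0)) :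
    wrongProb k γ ν fmin (ℓ + 1) = (ν.toOuterMeasure S).toReal *
      (1 - Real.exp (-(γ * wrongProb k γ ν fmin ℓ))) ^ (k - 1) := by
  classical
  have hr : 0 ≤ γ * wrongProb k γ ν fmin ℓ := mul_nonneg γ.coe_nonneg (wrongProb_nonneg ..)
  have h1 : (flowTreeLaw k γ ν (ℓ + 1)).map (wrongMark k fmin (ℓ + 1)) =
      ((flowTreeLaw k γ ν (ℓ + 1)).map
        (fun t => (rootFlow t, wrongCount k fmin ℓ t))).map fun sc =>
          if sc.1 ∈ S ∧ ∀ j, sc.2 j ≠ 0 then some () else none := by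
    rw [PMF.map_comp]
    refine map_congr_support fun t ht => ?_
    simp only [wrongMark, Function.comp, h t ht]
  have hs : ∀ s : ℕ, ((iidFamily ((counterLaw k γ ν ℓ).map (wrongNumber k fmin ℓ))
      (k - 1)).map fun c =>
        if s ∈ S ∧ ∀ j, c j ≠ 0 then some () else none) (some ()) =
      S.indicator (fun _ => ENNReal.ofReal
        ((1 - Real.exp (-(γ * wrongProb k γ ν fmin ℓ))) ^ (k - 1))) s := by
    intro s
    rw [PMF.map_apply]
    by_cases hsS : s ∈ S
    · rw [Set.indicator_of_mem hsS, ← tsum_ofReal_of_hasSum (flowWeight_nonneg hr)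
        (hasSum_flowWeight hr (k - 1))]
      refine tsum_congr fun c => ?_
      rw [← ite_iidFamily_eq_flowWeight hr (counterLaw_map_length_apply k γ ν fmin ℓ)]
      by_cases hc : ∀ j, c j ≠ 0 <;> simp [hsS, hc]
    · rw [Set.indicator_of_notMem hsS]
      exact ENNReal.tsum_eq_zero.2 fun c => by simp [hsS]
  rw [wrongProb, h1, flowTreeLaw_map_wrongCount, PMF.map_bind, PMF.bind_apply]
  simp only [PMF.map_comp]
  have hfin : ∑' s, ν s * S.indicator (fun _ => ENNReal.ofReal
      ((1 - Real.exp (-(γ * wrongProb k γ ν fmin ℓ))) ^ (k - 1))) s =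
      ν.toOuterMeasure S * ENNReal.ofReal
        ((1 - Real.exp (-(γ * wrongProb k γ ν fmin ℓ))) ^ (k - 1)) := by
    rw [PMF.toOuterMeasure_apply, ← ENNReal.tsum_mul_right]
    refine tsum_congr fun s => ?_
    by_cases hsS : s ∈ S <;> simp [hsS]
  have hnn : 0 ≤ (1 - Real.exp (-(γ * wrongProb k γ ν fmin ℓ))) ^ (k - 1) :=
    pow_nonneg (one_sub_exp_nonneg γ.coe_nonneg (wrongProb_nonneg ..)) _
  rw [← ENNReal.toReal_ofReal hnn, ← ENNReal.toReal_mul, ← hfin]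
  congr 1
  exact tsum_congr fun s => congrArg _ (hs s)

theorem wrongProb_odd {k : ℕ} (hk : 2 ≤ k) (γ : ℝ≥0) {ν : PMF ℕ} {fmin : ℕ}
    (hν : IsLeast ν.support fmin) (ℓ : ℕ) :
    wrongProb k γ ν fmin (2 * ℓ + 1) =
    (1 - Real.exp (-(γ * wrongProb k γ ν fmin (2 * ℓ)))) ^ (k - 1) := by
  rw [wrongProb_of_isWrong_iff Set.univ fun t ht => ?_]
  · have : ν.toOuterMeasure Set.univ = 1 :=
      (PMF.toOuterMeasure_apply_eq_one_iff ν _).2 (Set.subset_univ _)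
    rw [this, ENNReal.toReal_one, one_mul]
  · rw [isWrong_odd_iff hk (even_two_mul ℓ) t (sizesGE_of_mem_support hν.2 _ t ht)]
    simp

/-- Two decoder iterations make one step of density evolution, because the inner flow update is
already part of `g`. -/
theorem wrongProb_even {k : ℕ} (hk : 2 ≤ k) (γ : ℝ≥0) {ν : PMF ℕ} {fmin : ℕ}
    (hν : IsLeast ν.support fmin) (ℓ : ℕ) :
    wrongProb k γ ν fmin (2 * (ℓ + 1)) =
    f k (epsOf ν fmin) (g k γ (wrongProb k γ ν fmin (2 * ℓ))) := by
  rw [show 2 * (ℓ + 1) = 2 * ℓ + 1 + 1 by ring,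
    wrongProb_of_isWrong_iff {s | fmin < s} fun t ht =>
      isWrong_even_iff hk (odd_two_mul_add_one ℓ) t (sizesGE_of_mem_support hν.2 _ t ht),
    wrongProb_odd hk γ hν, f, g_eq_exp, epsOf]

theorem wrongProb_zero {k : ℕ} (γ : ℝ≥0) {ν : PMF ℕ} {fmin : ℕ} (hν : IsLeast ν.support fmin) :
    wrongProb k γ ν fmin 0 = epsOf ν fmin := by
  classical
  rw [wrongProb, epsOf, PMF.toOuterMeasure_apply, PMF.map_apply]
  congr 1
  have key : ∀ s : ℕ,
      (@ite _ (some () = wrongMark k fmin 0 s) (Classical.propDecidable _) (ν s) 0) =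
      {s | fmin < s}.indicator ν s := by
    intro s
    by_cases hs : ν s = 0
    · simp [hs, Set.indicator]
    · have hle : fmin ≤ s := hν.2 ((PMF.mem_support_iff _ _).2 hs)
      have hw : IsWrong k fmin 0 s ↔ fmin < s := by
        change (fmin : ℤ) ≠ (s : ℤ) ↔ _
        omega
      have hm : some () = wrongMark k fmin 0 s ↔ fmin < s := by
        by_cases hlt : fmin < s <;> simp [wrongMark, hw, hlt]
      by_cases hlt : fmin < s
      · rw [if_pos (hm.2 hlt), Set.indicator_of_mem (by exact hlt)]
      · rw [if_neg (mt hm.1 hlt), Set.indicator_of_notMem (by exact hlt)]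
  exact tsum_congr key

/-- The error probability converges to the largest fixed point of density evolution. -/
theorem tendsto_wrongProb {k : ℕ} (hk : 2 ≤ k) (γ : ℝ≥0) {ν : PMF ℕ} {fmin : ℕ}
    (hν : IsLeast ν.support fmin) {x : ℝ}
    (hx : IsLargestFixedPoint k γ (epsOf ν fmin) x) :
    Tendsto (fun ℓ => wrongProb k γ ν fmin (2 * ℓ)) atTop (𝓝 x) := by
  set ε := epsOf ν fmin with hε
  have hε0 : 0 ≤ ε := ENNReal.toReal_nonneg
  have hε1 : ε ≤ 1 := by
    rw [hε, epsOf]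
    refine ENNReal.toReal_le_of_le_ofReal zero_le_one ?_
    rw [ENNReal.ofReal_one]
    calc ν.toOuterMeasure {s | fmin < s} ≤ ν.toOuterMeasure Set.univ :=
          measure_mono (Set.subset_univ _)
      _ = 1 := (PMF.toOuterMeasure_apply_eq_one_iff ν _).2 (Set.subset_univ _)
  have hγ := γ.coe_nonneg
  have hF0 : ∀ u, 0 ≤ u → f k ε (g k γ u) ≤ ε := fun u hu =>
    mul_le_of_le_one_right hε0 (pow_le_one₀ (g_nonneg k hγ hu) (g_lt_one k γ u).le)
  have hFmono : ∀ u v, 0 ≤ u → u ≤ v → f k ε (g k γ u) ≤ f k ε (g k γ v) := fun u v hu huv =>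
    mul_le_mul_of_nonneg_left
      (pow_le_pow_left₀ (g_nonneg k hγ hu) (g_mono k hγ hu huv) _) hε0
  have hcont : Continuous fun u => f k ε (g k γ u) :=
    continuous_const.mul ((continuous_g k γ).pow _)
  have hw := wrongProb_nonneg k γ ν fmin
  -- The first step goes down because the map is bounded by its starting value `ε`; monotonicity
  -- propagates this.
  have hanti : Antitone fun ℓ => wrongProb k γ ν fmin (2 * ℓ) := by
    refine antitone_nat_of_succ_le fun ℓ => ?_
    induction ℓ with
    | zero =>
      rw [wrongProb_even hk γ hν, mul_zero, wrongProb_zero γ hν]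
      exact hF0 _ hε0
    | succ ℓ ih =>
      rw [wrongProb_even hk γ hν (ℓ + 1), wrongProb_even hk γ hν ℓ]
      rw [wrongProb_even hk γ hν ℓ] at ih
      exact hFmono _ _ (wrongProb_even hk γ hν ℓ ▸ hw _) ih
  have hlow : ∀ ℓ, x ≤ wrongProb k γ ν fmin (2 * ℓ) := by
    intro ℓ
    induction ℓ with
    | zero =>
      rw [mul_zero, wrongProb_zero γ hν, hx.1.2]
      exact hF0 x hx.1.1.1
    | succ ℓ ih =>
      rw [wrongProb_even hk γ hν, hx.1.2]
      exact hFmono _ _ hx.1.1.1 ih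
  have hlim := tendsto_atTop_ciInf hanti ⟨x, by rintro _ ⟨ℓ, rfl⟩; exact hlow ℓ⟩
  set L := ⨅ ℓ, wrongProb k γ ν fmin (2 * ℓ) with hL
  have hxL : x ≤ L := le_ciInf hlow
  have hL1 : L ≤ 1 := by
    have := hanti.le_of_tendsto hlim 0
    simp only [mul_zero, wrongProb_zero γ hν] at this
    exact this.trans hε1
  -- By continuity the limit is a fixed point; it lies above `x`, and maximality of `x` gives
  -- equality.
  have hfix : L = f k ε (g k γ L) := by
    refine tendsto_nhds_unique ((tendsto_add_atTop_iff_nat 1).2 hlim) ?_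
    simp only [wrongProb_even hk γ hν]
    exact (hcont.tendsto L).comp hlim
  have : L = x := le_antisymm (hx.2 ⟨⟨hx.1.1.1.trans hxL, hL1⟩, hfix⟩) hxL
  exact this ▸ hlim

/-! ### The residual ensemble -/

/-- The probability of the shape `T` of a peeled counter node if the messages coming into it are
wrong independently with probability `x`. -/
def treeWeight (k : ℕ) (γ x : ℝ) (T : CounterTree k) : ℝ :=
  Real.exp (-(γ * (1 - Real.exp (-(γ * x))) ^ (k - 1))) *
    (γ ^ T.length / (T.length.factorial : ℝ) * (T.map (flowWeight (γ * x))).prod)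

theorem treeWeight_nonneg (k : ℕ) {γ x : ℝ} (hγ : 0 ≤ γ) (hx : 0 ≤ x) (T : CounterTree k) :
    0 ≤ treeWeight k γ x T := by
  have : 0 ≤ (T.map (flowWeight (γ * x))).prod :=
    List.prod_nonneg (by
      simp only [List.mem_map]
      rintro _ ⟨c, -, rfl⟩
      exact flowWeight_nonneg (mul_nonneg hγ hx) c)
  unfold treeWeight
  positivity

theorem treeWeight_nil (k : ℕ) (γ x : ℝ) : treeWeight k γ x [] = 1 - g k γ x := by
  simp [treeWeight, g_eq_exp]

theorem continuous_treeWeight (k : ℕ) (γ : ℝ) (T : CounterTree k) :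
    Continuous fun x => treeWeight k γ x T := by
  have h1 : ∀ m, Continuous fun x => positiveWeight (γ * x) m := by
    intro m
    unfold positiveWeight poissonWeight
    split_ifs <;> fun_prop
  have h2 : ∀ c : Fin (k - 1) → ℕ, Continuous fun x => flowWeight (γ * x) c := fun c =>
    continuous_finsetProd _ fun j _ => h1 (c j)
  have h3 : Continuous fun x => (T.map (flowWeight (γ * x))).prod :=
    continuous_list_prod T fun c _ => h2 c
  unfold treeWeight
  fun_prop

theorem map_filter_eq_filterMap {α β : Type} (p : α → Prop) [DecidablePred p] (F : α → β)
    (l : List α) :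
    (l.filter fun a => p a).map F = l.filterMap fun a => if p a then some (F a) else none := by
  induction l with
  | nil => rfl
  | cons a l ih => by_cases h : p a <;> simp [h, ih]

theorem peel_eq_filterMap (k fmin ℓ : ℕ) (ts : List (FlowTree k (2 * ℓ + 1))) :
    peel k fmin ℓ ts = ts.filterMap fun t =>
      (open Classical in if IsWrong k fmin (2 * ℓ + 1) t then
        some (wrongCount k fmin (2 * ℓ) t) else none) := by
  classical
  exact map_filter_eq_filterMap _ (wrongCount k fmin (2 * ℓ)) ts

theorem toReal_prod_map_ofReal {α : Type} {w : α → ℝ} (hw : ∀ a, 0 ≤ w a) (l : List α) :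
    (l.map fun a => ENNReal.ofReal (w a)).prod.toReal = (l.map w).prod := by
  induction l with
  | nil => simp
  | cons a l ih =>
    rw [List.map_cons, List.prod_cons, ENNReal.toReal_mul, ih, ENNReal.toReal_ofReal (hw a),
      List.map_cons, List.prod_cons]

/-- Marking each inner flow by its wrong counts if all are nonzero, and by `none` otherwise, turns
peeling into Poisson thinning. A flow survives with total weight `(1 - exp (-γ x)) ^ (k - 1)`, which
supplies the exponential prefactor of `treeWeight`. -/
theorem peeledLaw_apply {k : ℕ} (hk : 2 ≤ k) (γ : ℝ≥0) {ν : PMF ℕ} {fmin : ℕ}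
    (hν : IsLeast ν.support fmin) (ℓ : ℕ) (T : CounterTree k) :
    (peeledLaw k γ ν fmin ℓ T).toReal = treeWeight k γ (wrongProb k γ ν fmin (2 * ℓ)) T := by
  classical
  set x := wrongProb k γ ν fmin (2 * ℓ) with hx
  have hx0 : 0 ≤ x := wrongProb_nonneg ..
  have hr : 0 ≤ γ * x := mul_nonneg γ.coe_nonneg hx0
  have hmap : (flowTreeLaw k γ ν (2 * ℓ + 1)).map (fun t =>
      if IsWrong k fmin (2 * ℓ + 1) t then some (wrongCount k fmin (2 * ℓ) t) else none) =
      (iidFamily ((counterLaw k γ ν (2 * ℓ)).map (wrongNumber k fmin (2 * ℓ))) (k - 1)).map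
        fun c => if ∀ j, c j ≠ 0 then some c else none := by
    have h1 := congrArg (PMF.map Prod.snd) (flowTreeLaw_map_wrongCount k γ ν fmin (2 * ℓ))
    simp only [PMF.map_bind, PMF.map_comp] at h1
    have h2 : (flowTreeLaw k γ ν (2 * ℓ + 1)).map (wrongCount k fmin (2 * ℓ)) =
        iidFamily ((counterLaw k γ ν (2 * ℓ)).map (wrongNumber k fmin (2 * ℓ))) (k - 1) :=
      h1.trans ((PMF.bind_const _ _).trans (PMF.map_id _))
    rw [← h2, PMF.map_comp]
    refine map_congr_support fun t ht => ?_
    simp only [Function.comp, isWrong_odd_iff hk (even_two_mul ℓ) t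
      (sizesGE_of_mem_support hν.2 _ t ht)]
  have hsome : ∀ c, (flowTreeLaw k γ ν (2 * ℓ + 1)).map (fun t =>
      if IsWrong k fmin (2 * ℓ + 1) t then some (wrongCount k fmin (2 * ℓ) t) else none) (some c) =
      ENNReal.ofReal (flowWeight (γ * x) c) := by
    intro c
    rw [hmap, ← ite_iidFamily_eq_flowWeight hr (counterLaw_map_length_apply k γ ν fmin (2 * ℓ)),
      PMF.map_apply, tsum_eq_single c]
    · by_cases hc : ∀ j, c j ≠ 0 <;> simp [hc]
    · intro c' hc'
      rw [if_neg]
      intro h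
      split_ifs at h
      exact hc' (Option.some.inj h).symm
  have hpeel : peel k fmin ℓ = List.filterMap fun t =>
      if IsWrong k fmin (2 * ℓ + 1) t then some (wrongCount k fmin (2 * ℓ) t) else none :=
    funext fun ts => peel_eq_filterMap k fmin ℓ ts
  have hnn : 0 ≤ (1 - Real.exp (-(γ * x))) ^ (k - 1) :=
    pow_nonneg (one_sub_exp_nonneg γ.coe_nonneg hx0) _
  rw [peeledLaw, counterLaw, hpeel, bind_iidList_filterMap_apply, toReal_none_add_tsum]
  simp only [hsome]
  rw [tsum_ofReal_of_hasSum (flowWeight_nonneg hr) (hasSum_flowWeight hr (k - 1)),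
    ENNReal.toReal_ofReal hnn, ENNReal.toReal_mul, ENNReal.toReal_ofReal (by positivity),
    toReal_prod_map_ofReal (flowWeight_nonneg hr), treeWeight, mul_div_assoc, mul_assoc]

/-- The generating identity of the peeled ensemble. -/
theorem hasSum_treeWeight_mul {k : ℕ} {γ x z : ℝ} (hγ : 0 ≤ γ) (hx : 0 ≤ x)
    (hz : z ∈ Set.Icc (0 : ℝ) 1) :
    HasSum (fun T : CounterTree k => treeWeight k γ x T * (1 - treeError T z))
      (1 - g k γ (x * z)) := by
  have hr : 0 ≤ γ * x := mul_nonneg hγ hx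
  have hp : ∀ m : ℕ, 0 ≤ 1 - (1 - z) ^ m ∧ 1 - (1 - z) ^ m ≤ 1 := fun m =>
    ⟨sub_nonneg.2 (pow_le_one₀ (by linarith [hz.2]) (by linarith [hz.1])),
      sub_le_self _ (pow_nonneg (by linarith [hz.2]) _)⟩
  have h1 := hasSum_flowWeight hr (k - 1)
  have h2 := hasSum_prod_tuple
    (fun m => mul_nonneg (positiveWeight_nonneg hr m) (hp m).1)
    (hasSum_positiveWeight_mul (γ * x) z) (k - 1)
  -- Total weight of the inner flows whose message is correct: all surviving ones minus the wrong
  -- ones.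
  have h3 := h1.sub h2
  have e : (fun c : Fin (k - 1) → ℕ =>
      flowWeight (γ * x) c - ∏ j, positiveWeight (γ * x) (c j) * (1 - (1 - z) ^ c j)) =
      fun c => flowWeight (γ * x) c * (1 - ∏ j, (1 - (1 - z) ^ c j)) := by
    funext c
    rw [Finset.prod_mul_distrib, flowWeight]
    ring
  rw [e] at h3
  have h4 := (hasSum_list_exp (fun c => mul_nonneg (flowWeight_nonneg hr c)
    (sub_nonneg.2 (Finset.prod_le_one (fun j _ => (hp (c j)).1) fun j _ => (hp (c j)).2)))
    hγ h3).mul_left (Real.exp (-(γ * (1 - Real.exp (-(γ * x))) ^ (k - 1))))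
  rw [← Real.exp_add] at h4
  -- The prefactor cancels the survival term of the exponent, leaving only the term in `x * z`.
  have e1 : 1 - g k γ (x * z) = Real.exp (-(γ * (1 - Real.exp (-(γ * x))) ^ (k - 1)) +
      γ * ((1 - Real.exp (-(γ * x))) ^ (k - 1) - (1 - Real.exp (-(γ * x * z))) ^ (k - 1))) := by
    rw [g_eq_exp, sub_sub_cancel]
    congr 1
    ring_nf
  have e2 : (fun T : CounterTree k => treeWeight k γ x T * (1 - treeError T z)) = fun T =>
      Real.exp (-(γ * (1 - Real.exp (-(γ * x))) ^ (k - 1))) *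
        (γ ^ T.length / (T.length.factorial : ℝ) *
          (T.map fun c => flowWeight (γ * x) c * (1 - ∏ j, (1 - (1 - z) ^ c j))).prod) := by
    funext T
    rw [treeWeight, treeError, sub_sub_cancel, List.prod_map_mul]
    ring
  rw [e1, e2]
  exact h4

theorem hasSum_treeWeight {k : ℕ} {γ x : ℝ} (hγ : 0 ≤ γ) (hx : 0 ≤ x) :
    HasSum (fun T : CounterTree k => treeWeight k γ x T) 1 := by
  have h := (hasSum_list_exp (flowWeight_nonneg (mul_nonneg hγ hx)) hγ
    (hasSum_flowWeight (mul_nonneg hγ hx) (k - 1))).mul_left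
      (Real.exp (-(γ * (1 - Real.exp (-(γ * x))) ^ (k - 1))))
  rwa [← Real.exp_add, neg_add_cancel, Real.exp_zero] at h

/-- The residual law: the peeled law conditioned on a nonempty tree. -/
def residualWeight (k : ℕ) (γ x : ℝ) (T : CounterTree k) : ℝ :=
  if T = [] then 0 else treeWeight k γ x T / g k γ x

theorem residualWeight_nonneg (k : ℕ) {γ x : ℝ} (hγ : 0 ≤ γ) (hx : 0 ≤ x) (T : CounterTree k) :
    0 ≤ residualWeight k γ x T := by
  unfold residualWeight
  split_ifs
  exacts [le_rfl, div_nonneg (treeWeight_nonneg k hγ hx T) (g_nonneg k hγ hx)]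

theorem hasSum_residualWeight {k : ℕ} {γ x : ℝ} (hγ : 0 < γ) (hx : 0 < x) :
    HasSum (residualWeight k γ x) 1 := by
  have hg := (g_pos k hγ hx).ne'
  -- The mass of the empty tree is removed from total mass `1`; what remains is `g k γ x`, the
  -- normalizing constant.
  have h := ((hasSum_treeWeight (k := k) hγ.le hx.le).sub
    (hasSum_ite_eq ([] : CounterTree k) (treeWeight k γ x []))).div_const (g k γ x)
  rw [treeWeight_nil, sub_sub_cancel, div_self hg] at h
  have e : residualWeight k γ x = fun T => (treeWeight k γ x T -
      if T = [] then 1 - g k γ x else 0) / g k γ x := by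
    funext T
    rw [residualWeight]
    split_ifs with hT
    · rw [hT, treeWeight_nil, sub_self, zero_div]
    · rw [sub_zero]
  rw [e]
  exact h

/-- The expected residual ensemble. -/
def residualLaw (k : ℕ) {γ x : ℝ} (hγ : 0 < γ) (hx : 0 < x) : PMF (CounterTree k) :=
  ⟨fun T => ENNReal.ofReal (residualWeight k γ x T), by
    have := tsum_ofReal_of_hasSum (residualWeight_nonneg k hγ.le hx.le)
      (hasSum_residualWeight (k := k) hγ hx)
    rw [ENNReal.ofReal_one] at this
    exact this ▸ ENNReal.summable.hasSum⟩

theorem residualLaw_toReal (k : ℕ) {γ x : ℝ} (hγ : 0 < γ) (hx : 0 < x) (T : CounterTree k) :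
    (residualLaw k hγ hx T).toReal = residualWeight k γ x T :=
  ENNReal.toReal_ofReal (residualWeight_nonneg k hγ.le hx.le T)

theorem ne_of_mem_support_residualLaw (k : ℕ) {γ x : ℝ} (hγ : 0 < γ) (hx : 0 < x)
    {T : CounterTree k} (hT : T ∈ (residualLaw k hγ hx).support) :
    T ≠ [] ∧ ∀ c ∈ T, ∀ j, c j ≠ 0 := by
  have h : residualWeight k γ x T ≠ 0 := fun h => hT (by
    change ENNReal.ofReal _ = 0
    rw [h, ENNReal.ofReal_zero])
  rw [residualWeight] at h
  refine ⟨fun h' => h (if_pos h'), fun c hc j hj => h ?_⟩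
  have h0 : flowWeight (γ * x) c = 0 :=
    Finset.prod_eq_zero (Finset.mem_univ j) (by rw [positiveWeight, if_pos hj])
  rw [treeWeight, List.prod_eq_zero (List.mem_map.2 ⟨c, hc, h0⟩)]
  simp

theorem counterUpdate_residualLaw (k : ℕ) {γ x z : ℝ} (hγ : 0 < γ) (hx : 0 < x)
    (hz : z ∈ Set.Icc (0 : ℝ) 1) :
    counterUpdate (residualLaw k hγ hx) z = g k γ (x * z) / g k γ x := by
  have h := ((hasSum_treeWeight (k := k) hγ.le hx.le).sub
    (hasSum_treeWeight_mul hγ.le hx.le hz)).div_const (g k γ x)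
  rw [sub_sub_cancel] at h
  rw [counterUpdate, ← h.tsum_eq]
  refine tsum_congr fun T => ?_
  rw [residualLaw_toReal, residualWeight]
  split_ifs with hT
  -- The excluded empty tree would contribute nothing, as its error is `0`.
  · simp [hT, treeError]
  · ring

/-- At every finite `ℓ` the residual probability is the same formula, evaluated at the current error
probability. It passes to the limit by continuity, as `g k γ x > 0`. -/
theorem isResidualEnsemble_residualLaw {k : ℕ} (hk : 2 ≤ k) {γ : ℝ≥0} (hγ : 0 < γ) {ν : PMF ℕ}
    {fmin : ℕ} (hν : IsLeast ν.support fmin) {x : ℝ}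
    (hx : IsLargestFixedPoint k γ (epsOf ν fmin) x) (hx0 : 0 < x) :
    IsResidualEnsemble k γ ν fmin (residualLaw k (NNReal.coe_pos.2 hγ) hx0) := by
  intro T
  have hlim := tendsto_wrongProb hk γ hν hx
  simp only [residualLaw_toReal, residualWeight, residualProb, peeledLaw_apply hk γ hν,
    treeWeight_nil, sub_sub_cancel]
  split_ifs
  · exact tendsto_const_nhds
  · exact (((continuous_treeWeight k γ T).tendsto x).comp hlim).div
      (((continuous_g k γ).tendsto x).comp hlim) (g_pos k (NNReal.coe_pos.2 hγ) hx0).ne'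

end CounterBraid

end

/-! ### Assembly of the theorem -/

theorem mainTheorem2 (k : ℕ) (hk : 2 ≤ k) (γ : ℝ≥0) (hγ : 0 < γ) :
    -- the EBP EXIT curve of the expected residual graph
    (∀ (ν : PMF ℕ) (fmin : ℕ), IsLeast ν.support fmin →
      ∀ x : ℝ, CounterBraid.IsLargestFixedPoint k γ (CounterBraid.epsOf ν fmin) x → 0 < x →
        ∃ P : PMF (CounterBraid.CounterTree k),
          CounterBraid.IsResidualEnsemble k γ ν fmin P ∧
          -- decoding is stuck: next to every edge each counter has a further residual flow
          (∀ T ∈ P.support, T ≠ [] ∧ ∀ c ∈ T, ∀ j, c j ≠ 0) ∧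
          ∀ z ∈ Set.Ioc (0 : ℝ) 1,
            0 < CounterBraid.counterUpdate P z ∧
            CounterBraid.counterUpdate P z = 1 - CounterBraid.rhoTilde k γ x (1 - z) ∧
            CounterBraid.ebpEps k (CounterBraid.counterUpdate P) z =
              CounterBraid.epsTilde k γ x z ∧
            CounterBraid.ebpH k (CounterBraid.counterUpdate P) z =
              CounterBraid.hTilde k γ x z) ∧
    -- the area under this curve is zero precisely at the area threshold
    (∀ ε x : ℝ, CounterBraid.IsLargestFixedPoint k γ ε x →
      (CounterBraid.IsAreaThreshold k γ ε →
        0 < x ∧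
        IntervalIntegrable
          (fun z => CounterBraid.hTilde k γ x z * deriv (CounterBraid.epsTilde k γ x) z)
          volume 0 1 ∧
        ∫ z in (0 : ℝ)..1,
          CounterBraid.hTilde k γ x z * deriv (CounterBraid.epsTilde k γ x) z = 0) ∧
      (0 < x →
        ∫ z in (0 : ℝ)..1,
          CounterBraid.hTilde k γ x z * deriv (CounterBraid.epsTilde k γ x) z = 0 →
        CounterBraid.IsAreaThreshold k γ ε)) := by
  have hγ' : (0 : ℝ) < γ := NNReal.coe_pos.2 hγ
  refine ⟨fun ν fmin hν x hx hx0 => ?_, fun ε x hx => ⟨fun h => ?_, fun hx0 h => ?_⟩⟩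
  · refine ⟨CounterBraid.residualLaw k hγ' hx0,
      CounterBraid.isResidualEnsemble_residualLaw hk hγ hν hx hx0,
      fun T hT => CounterBraid.ne_of_mem_support_residualLaw k hγ' hx0 hT, fun z hz => ?_⟩
    have hu := CounterBraid.counterUpdate_residualLaw k hγ' hx0 ⟨hz.1.le, hz.2⟩
    refine ⟨?_, ?_, ?_, ?_⟩
    · rw [hu]
      exact div_pos (CounterBraid.g_pos k hγ' (mul_pos hx0 hz.1)) (CounterBraid.g_pos k hγ' hx0)
    · rw [hu, CounterBraid.one_sub_rhoTilde]
    -- A point of the curve involves the update only through its value at `z`, so agreement on `(0,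
    -- 1]` is enough.
    · rw [CounterBraid.epsTilde_eq, CounterBraid.ebpEps, CounterBraid.ebpEps, hu]
    · rw [CounterBraid.hTilde_eq, CounterBraid.ebpH, CounterBraid.ebpH, hu]
  · obtain ⟨hx0, hΦ⟩ :=
      (CounterBraid.isAreaThreshold_iff_of_isLargestFixedPoint hk hγ' hx).1 h
    obtain ⟨hi, ha⟩ := CounterBraid.residualArea hk hγ' hx0
    exact ⟨hx0, hi, by rw [ha, hΦ, zero_div]⟩
  · refine (CounterBraid.isAreaThreshold_iff_of_isLargestFixedPoint hk hγ' hx).2 ⟨hx0, ?_⟩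
    rw [(CounterBraid.residualArea hk hγ' hx0).2, div_eq_zero_iff] at h
    exact h.resolve_right (mul_pos hx0 (CounterBraid.g_pos k hγ' hx0)).ne'
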